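/- For each $N\ge 1$ consider a network with $N$ users (transmitter-receiver pairs) and $N$ channels. Let $h_{m,n,k}=h^{(N)}_{m,n,k}$ be the random complex coefficient between user $m$'s transmitter and user $n$'s receiver in channel $k$, and write $h_{n,k}=h_{n,n,k}$. Let $P_n=P^{(N)}_n>0$ be the powers, $w_n=w^{(N)}_n$ the weights, and $N_0>0$ the noise variance. For an allocation $\mathbf a\in\{1,\dots,N\}^N$ of channels to users put $$u_n(\mathbf a)=\log_2\Bigl(1+\frac{P_n|h_{n,a_n}|^2}{N_0+\sum_{m\ne n,\;a_m=a_n}|h_{m,n,a_n}|^2P_m}\Bigr),\qquad W(\mathbf a)=\sum_{n=1}^N w_nu_n(\mathbf a).$$ The Naive-FSIG is the game in which each user $n$ chooses a channel $a_n$ and has utility $u_n$. A pure Nash equilibrium (PNE) is an allocation in which no user can increase his utility by changing only his own channel, and the pure price of anarchy is $\mathrm{PPoA}_N=\max_{\mathbf a}W(\mathbf a)/\min_{\mathbf a\text{ PNE}}W(\mathbf a)$ (read as $0$ if there is no PNE or the minimum is $0$). The strong interference event is $$\mathrm{SI}_N=\Bigl\{\tfrac1{N_0}\min_k|h_{n,k}|^2>\max_l\frac{|h_{n,l}|^2}{N_0+\min_{m\neq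 n}|h_{m,n,l}|^2P_m}\ \text{ for every } n\Bigr\}.$$ Assume that for each $N$: * the coefficients $h_{m,n,k}$, $1\le m,n,k\le N$, are independent; * for each $n$, the variables $|h_{n,1}|,\dots,|h_{n,N}|$ have a common continuous distribution function $F_n=F^{(N)}_n$. Assume also that, uniformly in $N$ and $n$: * for every $x>0$, $\inf_{N,n}F^{(N)}_n(x)>0$; * $P_n\le P_{\max}<\infty$ and $0<w_{\min}\le w_n\le w_{\max}<\infty$. The laws of the interference coefficients $h_{m,n,k}$, $m\ne n$, are arbitrary and may depend on $N$. Then: 1. For every real $\mu<1$ there are random sets $S_N$ of PNE of the Naive-FSIG such that, as $N\to\infty$, $\Pr\bigl(\mathrm{SI}_N\text{ holds and }|S_N|<\lceil N^\mu\rceil!\bigr)\to0$, and $\Pr\bigl(\exists\,\mathbf a\in S_N:\ \frac1N\sum_n w_nu_n(\mathbf a)\ge\varepsilon\bigr)\to0$ for every $\varepsilon>0$. 2. If in addition there is $x>0$ with $\sup_{N,n}F^{(N)}_n(x)<1$, then $\Pr\bigl(\mathrm{SI}_N\text{ holds and }\mathrm{PPoA}_N<C\bigr)\to0$ for every real $C$.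 In particular, suppose strong interference holds with probability tending to $1$. Then with probability tending to $1$ there are at least $\lceil N^\mu\rceil!$ PNE whose average weighted utility tends to $0$ in probability (uniformly over these PNE), and, under the condition in 2, the pure price of anarchy tends to infinity in probability. -/

import Mathlib

open MeasureTheory ProbabilityTheory Filter
open scoped Topology Nat

/-- A normal-form game with players `ι`, in which player `n` has the set `A n` of pure strategies. -/
structure NormalFormGame (ι : Type*) (A : ι → Type*) where
  /-- `utility n a` is the utility of player `n` under the strategy profile `a`. -/
  utility : ι → (∀ n, A n) → ℝ

namespace NormalFormGame

variable {ι : Type*} {A : ι → Type*}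

/-- `a` is a pure Nash equilibrium: no player gains by changing only his own strategy. -/
def IsPureNash [DecidableEq ι] (G : NormalFormGame ι A) (a : ∀ n, A n) : Prop :=
  ∀ (n : ι) (s : A n), G.utility n (Function.update a n s) ≤ G.utility n a

/-- The pure price of anarchy of `G` for the performance function `W`: the maximum of `W` over all
strategy profiles divided by its minimum over the pure Nash equilibria. For finite games these are
attained; the value is `0` if there is no pure Nash equilibrium. -/
noncomputable def purePriceOfAnarchy [DecidableEq ι] (G : NormalFormGame ι A)
    (W : (∀ n, A n) → ℝ) : ℝ :=
  (⨆ a, W a) / (⨅ a : {a : ∀ n, A n // G.IsPureNash a}, W a.1)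

end NormalFormGame

namespace InterferenceNetwork

/- A network of `N` transmitter-receiver pairs (users) and `K` channels: `h m n k` is the coefficient
between the transmitter of user `m` and the receiver of user `n` in channel `k` (so `h n n k` is the
direct coefficient of user `n`), `P n` is the transmission power of user `n`, and `N₀` the noise
variance. An allocation is a map `a` from users to channels. -/

variable {N K : ℕ}

/-- The interference that user `n` experiences in channel `k`, caused by the other users there. -/
noncomputable def interference (h : Fin N → Fin N → Fin K → ℂ) (P : Fin N → ℝ)
    (a : Fin N → Fin K) (n : Fin N) (k : Fin K) : ℝ :=
  ∑ m with m ≠ n ∧ a m = k, ‖h m n k‖ ^ 2 * P m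

/-- The achievable rate of user `n`, treating interference as noise. -/
noncomputable def rate (N₀ : ℝ) (h : Fin N → Fin N → Fin K → ℂ) (P : Fin N → ℝ)
    (n : Fin N) (a : Fin N → Fin K) : ℝ :=
  Real.logb 2 (1 + P n * ‖h n n (a n)‖ ^ 2 / (N₀ + interference h P a n (a n)))

/-- The performance function: the weighted sum of achievable rates. -/
noncomputable def weightedSumRate (N₀ : ℝ) (h : Fin N → Fin N → Fin K → ℂ) (P w : Fin N → ℝ)
    (a : Fin N → Fin K) : ℝ :=
  ∑ n, w n * rate N₀ h P n a

/-- The naive frequency-selective interference game: every user picks one of the `K` channels and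
his utility is his achievable rate. -/
noncomputable def naiveFSIG (N₀ : ℝ) (h : Fin N → Fin N → Fin K → ℂ) (P : Fin N → ℝ) :
    NormalFormGame (Fin N) (fun _ => Fin K) where
  utility := rate N₀ h P

/-- Strong interference at every user `n`; the inner minimum is over the interferers `m ≠ n`. -/
def StrongInterference (N₀ : ℝ) (h : Fin N → Fin N → Fin K → ℂ) (P : Fin N → ℝ) : Prop :=
  ∀ n : Fin N,
    (⨆ l : Fin K, ‖h n n l‖ ^ 2 / (N₀ + ⨅ m : {m : Fin N // m ≠ n}, ‖h m.1 n l‖ ^ 2 * P m.1)) <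
      1 / N₀ * ⨅ k : Fin K, ‖h n n k‖ ^ 2

end InterferenceNetwork

/-! Under strong interference every allocation of distinct channels is an equilibrium: there are as
many channels as users, so a deviating user meets an occupant, and even the weakest interferer on
the best channel costs more than keeping the worst channel free of interference. Bad equilibria are
therefore perfect matchings in the random user-channel graph whose edges are the pairs with direct
gain `≤ y`.

These edges are independent with probability bounded below, by the assumption on `F`. A quantitative
Hall theorem (`factorial_le_ncard_distinctRepresentatives`) reduces a shortage of matchings to an
empty rectangle, either with sides summing to `N + 1` or in the row of a vertex of small degree. A
union bound shows that such rectangles are improbable (`tendsto_measure_ncard_matchings_lt`). Each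
matching has average utility `O(y ^ 2)`, and `y` is arbitrary.

The sets `S_N` must not depend on `ε`, so they consist of the equilibria with the smallest average.
For the price of anarchy, a second matching with all gains above `x` beats a bad one user by user by
any prescribed factor; the powers cancel, so they need no lower bound. -/

/-! ### Counting perfect matchings -/

/-- The systems of distinct representatives of a family of finite sets. -/
def distinctRepresentatives {ι α : Type*} (t : ι → Finset α) : Set (ι → α) :=
  {f | Function.Injective f ∧ ∀ i, f i ∈ t i}

/-- **Marshall Hall's theorem**: if a family of finite sets satisfies Hall's condition and each of
its members has at least `d` elements, where `d` is at most the number of members, then it has at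
least `d !` systems of distinct representatives. -/
theorem factorial_le_ncard_distinctRepresentatives {ι : Type*} {α : Type*} [Fintype ι] [Finite α]
    [DecidableEq α] (t : ι → Finset α) (ht : ∀ s : Finset ι, s.card ≤ (s.biUnion t).card) (d : ℕ)
    (hd : ∀ i, d ≤ (t i).card) (hdι : d ≤ Fintype.card ι) :
    d ! ≤ (distinctRepresentatives t).ncard := by
  classical
  induction hn : Fintype.card ι using Nat.strongRecOn generalizing ι d with | ind n ih => _
  obtain _ | d := d
  · obtain ⟨f, hf⟩ := HallMarriageTheorem.hall_hard_inductive ht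
    rw [Nat.factorial_zero, Nat.one_le_iff_ne_zero, ← Nat.pos_iff_ne_zero, Set.ncard_pos]
    exact ⟨f, hf⟩
  have : Nonempty ι := Fintype.card_pos_iff.mp (by lia)
  by_cases! h : ∀ s : Finset ι, s.Nonempty → s ≠ Finset.univ → s.card < (s.biUnion t).card
  -- Hall's condition has slack: any of the `d + 1` or more values at `x` can be fixed and erased
  -- from the other sets, each choice leaving at least `d !` systems.
  · let x := Classical.arbitrary ι
    let ι' := { x' : ι | x' ≠ x }
    have card_ι' : Fintype.card ι' = Fintype.card ι - 1 := Set.card_ne_eq _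
    have key (y : α) : d ! ≤
        (distinctRepresentatives fun x' : ι' => (t x').erase y).ncard := by
      refine ih (Fintype.card ι') (card_ι'.trans_lt (by lia)) _
        (HallMarriageTheorem.hall_cond_of_erase y h) d (fun i => ?_)
        (le_of_le_of_eq (by lia) card_ι'.symm) rfl
      exact (Nat.le_sub_one_of_lt (hd i)).trans Finset.pred_card_le_card_erase
    let ext (y : α) (f : ι' → α) : ι → α := fun z => if hz : z = x then y else f ⟨z, hz⟩
    have ext_inj (y : α) : Function.Injective (ext y) := fun f g hfg => by
      funext ⟨z, hz⟩
      have hz' : ¬ z = x := hz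
      simpa [ext, hz'] using congrFun hfg z
    have hsub : ↑((t x).biUnion fun y => ((Set.toFinite (distinctRepresentatives
        fun x' : ι' => (t x').erase y)).toFinset.image (ext y))) ⊆ distinctRepresentatives t := by
      intro g hg
      simp only [Finset.coe_biUnion, Finset.coe_image, Set.Finite.coe_toFinset,
        Set.mem_iUnion, Set.mem_image] at hg
      obtain ⟨y, hy, f, ⟨hfi, hft⟩, rfl⟩ := hg
      have hne {z} : y ≠ f z := fun h => by simpa [← h] using hft z
      refine ⟨fun z₁ z₂ => ?_, fun z => ?_⟩
      · by_cases h₁ : z₁ = x <;> by_cases h₂ : z₂ = x <;>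
          simp [ext, h₁, h₂, hfi.eq_iff, hne, hne.symm]
      · by_cases hz : z = x
        · simpa [ext, hz] using hy
        · simpa [ext, hz] using Finset.mem_of_mem_erase (hft ⟨z, hz⟩)
    refine le_trans ?_ (Set.ncard_le_ncard hsub)
    rw [Set.ncard_coe_finset, Finset.card_biUnion]
    · rw [Nat.factorial_succ]
      refine (Nat.mul_le_mul_right _ (hd x)).trans ?_
      rw [← smul_eq_mul]
      refine Finset.card_nsmul_le_sum _ _ _ fun y _ => ?_
      rw [Finset.card_image_of_injective _ (ext_inj y), ← Set.ncard_eq_toFinset_card]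
      exact key y
    · intro y _ y' _ hyy'
      rw [Function.onFun, Finset.disjoint_left]
      simp only [Finset.mem_image, not_exists, not_and]
      rintro _ ⟨f, _, rfl⟩ g _ hfg
      exact hyy' (by simpa [ext] using (congrFun hfg x).symm)
  -- A tight subfamily `s` already has `(d + 1)!` systems; one fixed system `g` of the other sets,
  -- avoiding the union over `s`, extends them all.
  · obtain ⟨s, sne, snu, sle⟩ := h
    have hus : s.card = (s.biUnion t).card := (ht s).antisymm sle
    have hlt : s.card < Fintype.card ι := (Finset.card_lt_iff_ne_univ _).mpr snu
    obtain ⟨g, hgi, hgt⟩ :=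
      HallMarriageTheorem.hall_hard_inductive (HallMarriageTheorem.hall_cond_of_compl hus ht)
    -- A single member of `s` puts `d + 1` elements into a union of only `s.card` elements.
    have hds : d + 1 ≤ s.card := by
      obtain ⟨i, hi⟩ := sne
      exact (hd i).trans ((Finset.card_le_card (Finset.subset_biUnion_of_mem t hi)).trans sle)
    have key : (d + 1)! ≤ (distinctRepresentatives fun x' : (s : Set ι) => t x').ncard :=
      ih s.card (by lia) _ (HallMarriageTheorem.hall_cond_of_restrict ht) _ (fun i => hd i)
        (by simpa using hds) (by simp)
    have hgs (z : ι) (hz : z ∉ s) (y : (s : Set ι)) : g ⟨z, hz⟩ ∉ t y := fun hmem =>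
      (Finset.mem_sdiff.mp (hgt ⟨z, hz⟩)).2 (Finset.mem_biUnion.mpr ⟨y, y.2, hmem⟩)
    refine key.trans (Set.ncard_le_ncard_of_injOn
      (fun f z => if hz : z ∈ s then f ⟨z, hz⟩ else g ⟨z, hz⟩) ?_ ?_)
    · rintro f ⟨hfi, hft⟩
      refine ⟨?_, fun z => ?_⟩
      · refine hfi.dite (fun z => z ∈ s) hgi fun {z z' hz hz'} heq => hgs z' hz' ⟨z, hz⟩ ?_
        rw [← heq]
        exact hft ⟨z, hz⟩
      · by_cases hz : z ∈ s
        · simpa [hz] using hft ⟨z, hz⟩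
        · simpa [hz] using (Finset.mem_sdiff.mp (hgt ⟨z, hz⟩)).1
    · intro f _ f' _ hff'
      funext ⟨z, hz⟩
      have hz' : z ∈ s := hz
      simpa [hz'] using congrFun hff' z

/-- If a bipartite graph between `Fin N` and `Fin N` has fewer than `M !` perfect matchings, then it
has an empty rectangle of semiperimeter `N + 1`, or a vertex of degree less than `M`. -/
theorem exists_empty_rectangle_of_ncard_lt {N M : ℕ} (hM : M ≤ N) (R : Fin N → Fin N → Prop)
    (hR : {f : Fin N → Fin N | Function.Injective f ∧ ∀ n, R n (f n)}.ncard < M !) :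
    (∃ s ∈ Finset.Icc 1 N, ∃ A B : Finset (Fin N), A.card = s ∧ B.card = N + 1 - s ∧
      ∀ n ∈ A, ∀ k ∈ B, ¬ R n k) ∨
    ∃ A B : Finset (Fin N), A.card = 1 ∧ B.card = N + 1 - M ∧ ∀ n ∈ A, ∀ k ∈ B, ¬ R n k := by
  classical
  by_contra! hcon
  obtain ⟨h₁, h₂⟩ := hcon
  refine hR.not_ge ?_
  let t : Fin N → Finset (Fin N) := fun n => Finset.univ.filter (R n)
  have heq : {f : Fin N → Fin N | Function.Injective f ∧ ∀ n, R n (f n)} =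
      distinctRepresentatives t := by
    ext f
    simp [distinctRepresentatives, t]
  rw [heq]
  refine factorial_le_ncard_distinctRepresentatives t (fun s => ?_) M (fun n => ?_) (by simpa)
  · by_contra! hs
    have hsN : s.card ≤ N := by simpa using s.card_le_univ
    obtain ⟨B, hB, hBc⟩ := Finset.exists_subset_card_eq (s := (s.biUnion t)ᶜ) (n := N + 1 - s.card)
      (by rw [Finset.card_compl, Fintype.card_fin]; lia)
    obtain ⟨n, hn, k, hk, hnk⟩ := h₁ s.card (Finset.mem_Icc.mpr ⟨by lia, hsN⟩) s B rfl hBc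
    exact Finset.mem_compl.mp (hB hk) (Finset.mem_biUnion.mpr ⟨n, hn, by simpa [t] using hnk⟩)
  · by_contra! hn
    obtain ⟨B, hB, hBc⟩ := Finset.exists_subset_card_eq (s := (t n)ᶜ) (n := N + 1 - M)
      (by rw [Finset.card_compl, Fintype.card_fin]; lia)
    obtain ⟨n', hn', k, hk, hnk⟩ := h₂ {n} B (by simp) hBc
    rw [Finset.mem_singleton] at hn'
    subst hn'
    exact Finset.mem_compl.mp (hB hk) (by simpa [t] using hnk)

/-! ### Matchings in random bipartite graphs -/

/-- Union bound for the existence of a rectangle `A × B` all of whose events `D n k` occur. -/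
theorem measureReal_exists_rectangle_le {Ω : Type*} [MeasurableSpace Ω] {Pr : Measure Ω}
    [IsProbabilityMeasure Pr] {N : ℕ} {D : Fin N → Fin N → Set Ω} {r : ℝ}
    (hD : ∀ S : Finset (Fin N × Fin N), Pr.real (⋂ i ∈ S, D i.1 i.2) ≤ r ^ S.card) (a b : ℕ) :
    Pr.real {ω | ∃ A B : Finset (Fin N), A.card = a ∧ B.card = b ∧
      ∀ n ∈ A, ∀ k ∈ B, ω ∈ D n k} ≤ N.choose a * N.choose b * r ^ (a * b) := by
  classical
  let I := (Finset.univ : Finset (Fin N)).powersetCard a ×ˢ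
    (Finset.univ : Finset (Fin N)).powersetCard b
  have hsub : {ω | ∃ A B : Finset (Fin N), A.card = a ∧ B.card = b ∧
      ∀ n ∈ A, ∀ k ∈ B, ω ∈ D n k} ⊆ ⋃ p ∈ I, ⋂ i ∈ p.1 ×ˢ p.2, D i.1 i.2 := by
    rintro ω ⟨A, B, hA, hB, hAB⟩
    simp only [Set.mem_iUnion, Set.mem_iInter]
    exact ⟨(A, B), by simp [I, hA, hB], fun i hi =>
      hAB _ (Finset.mem_product.mp hi).1 _ (Finset.mem_product.mp hi).2⟩
  refine (measureReal_mono hsub (measure_ne_top _ _)).trans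
    ((measureReal_biUnion_finset_le _ _).trans ?_)
  refine (Finset.sum_le_card_nsmul I _ (r ^ (a * b)) fun p hp => ?_).trans ?_
  · have hp' : p.1.card = a ∧ p.2.card = b := by simpa [I] using hp
    simpa [Finset.card_product, hp'.1, hp'.2] using hD (p.1 ×ˢ p.2)
  · simp [I, Finset.card_product, Finset.card_powersetCard]

/-- The longer side satisfies `2 * b ≥ N + 1`, so `ρ ^ (2 * a * b)` is at most the `a`-th power of
`ρ ^ (N + 1)`, while each binomial coefficient is at most `N ^ a`. This is why the edge-failure
bound is written as a square. -/
theorem choose_mul_choose_mul_pow_le {N : ℕ} {ρ : ℝ} (hρ₀ : 0 ≤ ρ) (hρ₁ : ρ ≤ 1) {a b : ℕ}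
    (hab : a + b = N + 1) (ha : 1 ≤ a) (hle : a ≤ b) (hN : (N : ℝ) ^ 2 * ρ ^ (N + 1) ≤ 1) :
    (N.choose a : ℝ) * N.choose b * (ρ ^ 2) ^ (a * b) ≤ (N : ℝ) ^ 2 * ρ ^ (N + 1) := by
  have hN1 : 1 ≤ N := by lia
  have h₁ : (N.choose a : ℝ) ≤ (N : ℝ) ^ a := by exact_mod_cast Nat.choose_le_pow N a
  have h₂ : (N.choose b : ℝ) ≤ (N : ℝ) ^ a := by
    have : N.choose b ≤ N ^ a := by
      rw [← Nat.choose_symm (by lia : b ≤ N)]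
      exact (Nat.choose_le_pow _ _).trans (Nat.pow_le_pow_right hN1 (by lia))
    exact_mod_cast this
  have h₃ : (ρ ^ 2) ^ (a * b) ≤ (ρ ^ (N + 1)) ^ a := by
    rw [← pow_mul, ← pow_mul]
    refine pow_le_pow_of_le_one hρ₀ hρ₁ ?_
    nlinarith
  calc (N.choose a : ℝ) * N.choose b * (ρ ^ 2) ^ (a * b)
      ≤ (N : ℝ) ^ a * (N : ℝ) ^ a * (ρ ^ (N + 1)) ^ a := by gcongr
    _ = ((N : ℝ) ^ 2 * ρ ^ (N + 1)) ^ a := by ring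
    _ ≤ (N : ℝ) ^ 2 * ρ ^ (N + 1) := pow_le_of_le_one (by positivity) hN (by lia)

theorem measureReal_ncard_matchings_lt_le {Ω : Type*} [MeasurableSpace Ω] {Pr : Measure Ω}
    [IsProbabilityMeasure Pr] {N M : ℕ} (hM₁ : 1 ≤ M) (hM : M ≤ N) {E : Fin N → Fin N → Set Ω}
    {ρ : ℝ} (hρ₀ : 0 ≤ ρ) (hρ₁ : ρ ≤ 1) (hN : (N : ℝ) ^ 2 * ρ ^ (N + 1) ≤ 1)
    (hE : ∀ S : Finset (Fin N × Fin N), Pr.real (⋂ i ∈ S, (E i.1 i.2)ᶜ) ≤ (ρ ^ 2) ^ S.card) :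
    Pr.real {ω | {f : Fin N → Fin N | Function.Injective f ∧ ∀ n, ω ∈ E n (f n)}.ncard < M !} ≤
      (N : ℝ) ^ 3 * ρ ^ (N + 1) + (N : ℝ) ^ M * (ρ ^ 2) ^ (N + 1 - M) := by
  let rect (a b : ℕ) : Set Ω := {ω | ∃ A B : Finset (Fin N), A.card = a ∧ B.card = b ∧
      ∀ n ∈ A, ∀ k ∈ B, ω ∈ (E n k)ᶜ}
  have hrect (a b : ℕ) : Pr.real (rect a b) ≤ N.choose a * N.choose b * (ρ ^ 2) ^ (a * b) :=
    measureReal_exists_rectangle_le (D := fun n k => (E n k)ᶜ) hE a b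
  have hsub : {ω | {f : Fin N → Fin N | Function.Injective f ∧ ∀ n, ω ∈ E n (f n)}.ncard < M !} ⊆
      (⋃ s ∈ Finset.Icc 1 N, rect s (N + 1 - s)) ∪ rect 1 (N + 1 - M) := fun ω hω => by
    rcases exists_empty_rectangle_of_ncard_lt hM (fun n k => ω ∈ E n k) hω with ⟨s, hs, h⟩ | h
    · exact Or.inl (Set.mem_biUnion hs h)
    · exact Or.inr h
  refine (measureReal_mono hsub (measure_ne_top _ _)).trans
    ((measureReal_union_le _ _).trans (add_le_add ?_ ?_))
  · refine (measureReal_biUnion_finset_le _ _).trans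
      ((Finset.sum_le_card_nsmul _ _ ((N : ℝ) ^ 2 * ρ ^ (N + 1)) fun s hs => ?_).trans_eq ?_)
    · refine (hrect _ _).trans ?_
      rw [Finset.mem_Icc] at hs
      rcases le_total s (N + 1 - s) with hle | hle
      · exact choose_mul_choose_mul_pow_le hρ₀ hρ₁ (by lia) hs.1 hle hN
      · rw [mul_comm (N.choose s : ℝ), mul_comm s]
        exact choose_mul_choose_mul_pow_le hρ₀ hρ₁ (by lia) (by lia) hle hN
    · rw [Nat.card_Icc, Nat.add_sub_cancel, nsmul_eq_mul, ← mul_assoc, ← pow_succ']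
  · refine (hrect _ _).trans ?_
    rw [one_mul, Nat.choose_one_right]
    gcongr
    -- By symmetry the binomial coefficient is that of `M - 1`.
    have : N * N.choose (N + 1 - M) ≤ N ^ M := by
      rw [← Nat.choose_symm (by lia : N + 1 - M ≤ N)]
      calc N * N.choose (N - (N + 1 - M)) ≤ N * N ^ (N - (N + 1 - M)) := by
            gcongr; exact Nat.choose_le_pow _ _
        _ = N ^ M := by rw [← pow_succ']; congr 1; lia
    exact_mod_cast this

/-- With `c = -log r` the logarithm is `M * (log N + c) - (N + 1) * c`, and the first term is `o(N)`
because `M ≤ N ^ μ + 1` with `μ < 1`. -/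
theorem tendsto_pow_ceil_rpow_mul_pow {μ r : ℝ} (hμ : μ < 1) (hr₀ : 0 < r) (hr₁ : r < 1) :
    Tendsto (fun N : ℕ => (N : ℝ) ^ ⌈(N : ℝ) ^ μ⌉₊ * r ^ (N + 1 - ⌈(N : ℝ) ^ μ⌉₊)) atTop (𝓝 0) := by
  set c : ℝ := -Real.log r with hc
  have hc₀ : 0 < c := neg_pos.mpr (Real.log_neg hr₀ hr₁)
  have hid : (fun x : ℝ => (x ^ μ + 1) * (Real.log x + c)) =o[atTop] fun x : ℝ => x := by
    -- Taking `ν` above `0` as well as `μ` lets `x ^ ν` absorb the `1` from the ceiling.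
    obtain ⟨ν, hν₁, hν₂⟩ := exists_between (max_lt hμ one_pos)
    have hμν : μ < ν := (le_max_left _ _).trans_lt hν₁
    have hν₀ : 0 < ν := (le_max_right _ _).trans_lt hν₁
    have h₁ : (fun x : ℝ => x ^ μ + 1) =O[atTop] fun x : ℝ => x ^ ν := by
      have key {s : ℝ} (hs : s ≤ ν) : (fun x : ℝ => x ^ s) =O[atTop] fun x : ℝ => x ^ ν := by
        refine Asymptotics.IsBigO.of_bound 1 ?_
        filter_upwards [eventually_ge_atTop 1] with x hx
        rw [one_mul, Real.norm_of_nonneg (by positivity), Real.norm_of_nonneg (by positivity)]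
        exact Real.rpow_le_rpow_of_exponent_le hx hs
      simpa using (key hμν.le).add (key hν₀.le)
    have h₂ : (fun x : ℝ => Real.log x + c) =o[atTop] fun x : ℝ => x ^ (1 - ν) := by
      refine (isLittleO_log_rpow_atTop (by linarith)).add ?_
      exact Asymptotics.isLittleO_const_left.mpr (Or.inr
        (tendsto_norm_atTop_atTop.comp (tendsto_rpow_atTop (by linarith))))
    refine (h₁.mul_isLittleO h₂).congr' EventuallyEq.rfl ?_
    filter_upwards [eventually_gt_atTop 0] with x hx
    rw [← Real.rpow_add hx]
    simp
  have hexp : Tendsto (fun N : ℕ => Real.exp (-(c / 2) * N)) atTop (𝓝 0) := by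
    refine Real.tendsto_exp_atBot.comp ?_
    exact (tendsto_natCast_atTop_atTop (R := ℝ)).const_mul_atTop_of_neg (by linarith)
  refine squeeze_zero' (Eventually.of_forall fun N => by positivity) ?_ hexp
  have hev := tendsto_natCast_atTop_atTop (R := ℝ) |>.eventually (hid.def (half_pos hc₀))
  filter_upwards [hev, eventually_ge_atTop 1] with N hN hN₁
  have hNr : (1 : ℝ) ≤ N := by exact_mod_cast hN₁
  have hMN : ⌈(N : ℝ) ^ μ⌉₊ ≤ N := by
    refine Nat.ceil_le.mpr ?_
    simpa using Real.rpow_le_rpow_of_exponent_le hNr hμ.le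
  have hMle : (⌈(N : ℝ) ^ μ⌉₊ : ℝ) ≤ (N : ℝ) ^ μ + 1 :=
    (Nat.ceil_lt_add_one (by positivity)).le
  set M := ⌈(N : ℝ) ^ μ⌉₊
  have hlog : 0 ≤ Real.log N := Real.log_nonneg hNr
  rw [Real.norm_of_nonneg (by positivity), Real.norm_of_nonneg (by positivity)] at hN
  have h₁ : (N : ℝ) ^ M * r ^ (N + 1 - M) =
      Real.exp (M * Real.log N - ((N + 1 - M : ℕ) : ℝ) * c) := by
    rw [sub_eq_add_neg, Real.exp_add, ← mul_neg, hc, neg_neg, Real.exp_nat_mul, Real.exp_nat_mul,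
      Real.exp_log (by linarith), Real.exp_log hr₀]
  rw [h₁, Nat.cast_sub (by lia)]
  push_cast
  gcongr
  have := mul_le_mul_of_nonneg_right hMle (by positivity : 0 ≤ Real.log N + c)
  nlinarith

/-- In a random bipartite graph on `N + N` vertices in which the edges are independent and have
probability bounded away from `0`, there are asymptotically almost surely at least `⌈N ^ μ⌉!`
perfect matchings. -/
theorem tendsto_measure_ncard_matchings_lt {Ω : Type*} [MeasurableSpace Ω] {Pr : Measure Ω}
    [IsProbabilityMeasure Pr] {E : (N : ℕ) → Fin N → Fin N → Set Ω} {r : ℝ} (hr : r < 1)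
    (hE : ∀ N, ∀ S : Finset (Fin N × Fin N),
      Pr.real (⋂ i ∈ S, (E N i.1 i.2)ᶜ) ≤ r ^ S.card) {μ : ℝ} (hμ : μ < 1) (hr₀ : 0 ≤ r) :
    Tendsto (fun N : ℕ => Pr {ω | {f : Fin N → Fin N | Function.Injective f ∧
      ∀ n, ω ∈ E N n (f n)}.ncard < ⌈(N : ℝ) ^ μ⌉₊ !}) atTop (𝓝 0) := by
  -- `r` may be `0`; the estimates need a positive base.
  obtain ⟨r', hr', hr'₁⟩ := exists_between hr
  have hr'₀ : 0 < r' := hr₀.trans_lt hr'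
  set ρ := √r' with hρ
  have hρ₀ : 0 < ρ := Real.sqrt_pos.mpr hr'₀
  have hρ₁ : ρ < 1 := by rw [hρ, Real.sqrt_lt' one_pos]; simpa
  have hρ₂ : ρ ^ 2 = r' := Real.sq_sqrt hr'₀.le
  have hpow (k : ℕ) : Tendsto (fun N : ℕ => (N : ℝ) ^ k * ρ ^ (N + 1)) atTop (𝓝 0) := by
    have := (tendsto_pow_const_mul_const_pow_of_abs_lt_one k
      (by rwa [abs_of_pos hρ₀])).mul_const ρ
    simpa [pow_succ, mul_assoc] using this
  have hlim := (hpow 3).add (tendsto_pow_ceil_rpow_mul_pow hμ hr'₀ hr'₁)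
  rw [add_zero] at hlim
  have hreal : Tendsto (fun N : ℕ => Pr.real {ω | {f : Fin N → Fin N | Function.Injective f ∧
      ∀ n, ω ∈ E N n (f n)}.ncard < ⌈(N : ℝ) ^ μ⌉₊ !}) atTop (𝓝 0) := by
    refine squeeze_zero' (Eventually.of_forall fun N => measureReal_nonneg) ?_ hlim
    filter_upwards [(hpow 2).eventually_le_const one_pos, eventually_ge_atTop 1] with N hN hN₁
    have hNr : (1 : ℝ) ≤ N := by exact_mod_cast hN₁
    rw [← hρ₂]
    refine measureReal_ncard_matchings_lt_le ?_ ?_ hρ₀.le hρ₁.le hN fun S => ?_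
    · exact Nat.one_le_ceil_iff.mpr (by positivity)
    · exact Nat.ceil_le.mpr (by simpa using Real.rpow_le_rpow_of_exponent_le hNr hμ.le)
    · rw [hρ₂]
      exact (hE N S).trans (pow_le_pow_left₀ hr₀ hr'.le _)
  exact (ENNReal.tendsto_toReal_zero_iff (fun _ => measure_ne_top _ _)).mp hreal

/-! ### Selecting equilibria and bounding the price of anarchy -/

/-- Among the elements of a finite set one can choose `m` (or all, if there are fewer) on which
`f` is smallest. -/
theorem exists_subset_card_eq_min_of_smallest {α : Type*} (T : Finset α) (f : α → ℝ) (m : ℕ) :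
    ∃ S ⊆ T, S.card = min m T.card ∧
      ∀ a ∈ S, ∀ ε ≤ f a, (T.filter fun b => f b < ε).card < m := by
  classical
  induction m with
  | zero => exact ⟨∅, by simp⟩
  | succ m ih =>
    obtain ⟨S, hST, hcard, hS⟩ := ih
    rcases (T \ S).eq_empty_or_nonempty with he | hne
    · have hST' : S = T := hST.antisymm (Finset.sdiff_eq_empty_iff_subset.mp he)
      subst hST'
      exact ⟨S, hST, by lia, fun a ha ε hε => (hS a ha ε hε).trans (Nat.lt_succ_self m)⟩
    · obtain ⟨a, ha, hmin⟩ := Finset.exists_min_image _ f hne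
      rw [Finset.mem_sdiff] at ha
      have hlt : S.card < T.card :=
        Finset.card_lt_card (Finset.ssubset_iff_of_subset hST |>.mpr ⟨a, ha⟩)
      refine ⟨insert a S, Finset.insert_subset ha.1 hST, ?_, fun b hb ε hε => ?_⟩
      · rw [Finset.card_insert_of_notMem ha.2]
        lia
      · rw [Finset.mem_insert] at hb
        obtain rfl | hb := hb
        · refine (Finset.card_le_card (t := S) fun c hc => ?_).trans_lt (by lia)
          rw [Finset.mem_filter] at hc
          by_contra hcS
          exact (hε.trans (hmin c (Finset.mem_sdiff.mpr ⟨hc.1, hcS⟩))).not_gt hc.2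
        · exact (hS b hb ε hε).trans (Nat.lt_succ_self m)

theorem exists_pos_mul_sq_lt (K : ℝ) {ε : ℝ} (hε : 0 < ε) : ∃ y : ℝ, 0 < y ∧ K * y ^ 2 < ε := by
  have hK : 0 < |K| + 1 := by positivity
  refine ⟨√(ε / (|K| + 1)), by positivity, ?_⟩
  rw [Real.sq_sqrt (by positivity), mul_div_assoc', div_lt_iff₀ hK, mul_comm]
  exact mul_lt_mul_of_pos_left (by linarith [le_abs_self K]) hε

namespace NormalFormGame

theorem le_purePriceOfAnarchy {ι : Type*} {A : ι → Type*} [DecidableEq ι] [Finite ι]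
    [∀ n, Finite (A n)] {G : NormalFormGame ι A} {W : (∀ n, A n) → ℝ}
    (hW : ∀ a, 0 < W a) {a b : ∀ n, A n} (hb : G.IsPureNash b) {C : ℝ}
    (hC : C * W b ≤ W a) : C ≤ G.purePriceOfAnarchy W := by
  have : Nonempty {a : ∀ n, A n // G.IsPureNash a} := ⟨⟨b, hb⟩⟩
  obtain ⟨c, hc⟩ := exists_eq_ciInf_of_finite (f := fun a : {a // G.IsPureNash a} => W a.1)
  have hpos : 0 < ⨅ a : {a : ∀ n, A n // G.IsPureNash a}, W a.1 := hc ▸ hW _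
  have hle : ⨅ a : {a : ∀ n, A n // G.IsPureNash a}, W a.1 ≤ W b :=
    ciInf_le (f := fun a : {a // G.IsPureNash a} => W a.1) (Set.finite_range _).bddBelow ⟨b, hb⟩
  have hsup : W a ≤ ⨆ a, W a := le_ciSup (Set.finite_range W).bddAbove a
  rw [purePriceOfAnarchy, le_div_iff₀ hpos]
  rcases le_total C 0 with h | h
  · exact (mul_nonpos_of_nonpos_of_nonneg h hpos.le).trans ((hW a).le.trans hsup)
  · exact (mul_le_mul_of_nonneg_left hle h).trans (hC.trans hsup)

end NormalFormGame

/-! ### Rates and equilibria in a fixed network -/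

namespace InterferenceNetwork

section Network

variable {N K : ℕ} {N₀ : ℝ} {h : Fin N → Fin N → Fin K → ℂ} {P w : Fin N → ℝ}

theorem interference_nonneg (hP : ∀ n, 0 < P n) (a : Fin N → Fin K) (n : Fin N) (k : Fin K) :
    0 ≤ interference h P a n k :=
  Finset.sum_nonneg fun m _ => mul_nonneg (sq_nonneg _) (hP m).le

theorem interference_eq_zero {a : Fin N → Fin K} (ha : Function.Injective a) (n : Fin N) :
    interference h P a n (a n) = 0 := by
  refine Finset.sum_eq_zero fun m hm => ?_
  rw [Finset.mem_filter] at hm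
  exact absurd (ha hm.2.2) hm.2.1

theorem rate_of_injective {a : Fin N → Fin K} (ha : Function.Injective a) (n : Fin N) :
    rate N₀ h P n a = Real.logb 2 (1 + P n * ‖h n n (a n)‖ ^ 2 / N₀) := by
  rw [rate, interference_eq_zero ha, add_zero]

theorem rate_pos (hN₀ : 0 < N₀) (hP : ∀ n, 0 < P n) (hgain : ∀ n k, 0 < ‖h n n k‖)
    (a : Fin N → Fin K) (n : Fin N) : 0 < rate N₀ h P n a := by
  have := hP n
  have := hgain n (a n)
  have := interference_nonneg (h := h) hP a n (a n)
  refine Real.logb_pos one_lt_two ?_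
  rw [lt_add_iff_pos_right]
  positivity

theorem weightedSumRate_pos (hN : 0 < N) (hN₀ : 0 < N₀) (hP : ∀ n, 0 < P n) (hw : ∀ n, 0 < w n)
    (hgain : ∀ n k, 0 < ‖h n n k‖) (a : Fin N → Fin K) : 0 < weightedSumRate N₀ h P w a :=
  Finset.sum_pos (fun n _ => mul_pos (hw n) (rate_pos hN₀ hP hgain a n))
    ⟨⟨0, hN⟩, Finset.mem_univ _⟩

theorem rate_le_of_norm_le (hN₀ : 0 < N₀) (hP : ∀ n, 0 < P n) {a : Fin N → Fin K} {n : Fin N}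
    {y : ℝ} (hy : ‖h n n (a n)‖ ≤ y) : rate N₀ h P n a ≤ P n * y ^ 2 / N₀ / Real.log 2 := by
  have := hP n
  have hI := interference_nonneg (h := h) hP a n (a n)
  have hx : 0 ≤ P n * ‖h n n (a n)‖ ^ 2 / (N₀ + interference h P a n (a n)) := by positivity
  have hle : P n * ‖h n n (a n)‖ ^ 2 / (N₀ + interference h P a n (a n)) ≤ P n * y ^ 2 / N₀ := by
    gcongr
    linarith
  rw [rate, Real.logb]
  refine div_le_div_of_nonneg_right ?_ (Real.log_pos one_lt_two).le
  linarith [Real.log_le_sub_one_of_pos (by linarith :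
    0 < 1 + P n * ‖h n n (a n)‖ ^ 2 / (N₀ + interference h P a n (a n)))]

/-- From `log (1 + t) ≥ t / (1 + t)`, with `P n` bounded by `Pmax` only in the denominator. The
remaining factor `P n` matches the one in `rate_le_of_norm_le`. -/
theorem le_rate_of_le_norm (hN₀ : 0 < N₀) (hP : ∀ n, 0 < P n) {a : Fin N → Fin K}
    (ha : Function.Injective a) {n : Fin N} {x Pmax : ℝ} (hx₀ : 0 ≤ x) (hmax : P n ≤ Pmax)
    (hx : x ≤ ‖h n n (a n)‖) :
    P n * (x ^ 2 / (1 + Pmax * x ^ 2 / N₀)) / N₀ / Real.log 2 ≤ rate N₀ h P n a := by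
  have hPn := hP n
  have hPmax : 0 < Pmax := hPn.trans_le hmax
  rw [rate_of_injective ha, Real.logb]
  refine div_le_div_of_nonneg_right ?_ (Real.log_pos one_lt_two).le
  set t := P n * x ^ 2 / N₀ with ht
  have ht₀ : 0 ≤ t := by positivity
  calc P n * (x ^ 2 / (1 + Pmax * x ^ 2 / N₀)) / N₀
      = t / (1 + Pmax * x ^ 2 / N₀) := by rw [ht]; ring
    _ ≤ t / (1 + t) := by rw [ht]; gcongr
    _ = 1 - (1 + t)⁻¹ := by field_simp; ring
    _ ≤ Real.log (1 + t) := Real.one_sub_inv_le_log_of_pos (by positivity)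
    _ ≤ Real.log (1 + P n * ‖h n n (a n)‖ ^ 2 / N₀) := by rw [ht]; gcongr

theorem average_weightedSumRate_lt (hN₀ : 0 < N₀) (hP : ∀ n, 0 < P n) {Pmax wmax y ε : ℝ}
    (hmax : ∀ n, P n ≤ Pmax) (hw : ∀ n, 0 < w n ∧ w n ≤ wmax) (hε : 0 < ε)
    (hyε : wmax * Pmax / N₀ / Real.log 2 * y ^ 2 < ε) {a : Fin N → Fin K}
    (ha : ∀ n, ‖h n n (a n)‖ ≤ y) : 1 / (N : ℝ) * weightedSumRate N₀ h P w a < ε := by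
  rcases N.eq_zero_or_pos with rfl | hN
  · simpa using hε
  refine lt_of_le_of_lt ?_ hyε
  have hlog := Real.log_pos one_lt_two
  have hsum : weightedSumRate N₀ h P w a ≤
      N * (wmax * Pmax / N₀ / Real.log 2 * y ^ 2) := by
    refine (Finset.sum_le_card_nsmul _ _ _ fun n _ => ?_).trans_eq
      (by rw [Finset.card_univ, Fintype.card_fin, nsmul_eq_mul])
    have hwn := hw n
    have hPn := hP n
    have hwmax : 0 < wmax := hwn.1.trans_le hwn.2
    calc w n * rate N₀ h P n a ≤ w n * (P n * y ^ 2 / N₀ / Real.log 2) :=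
          mul_le_mul_of_nonneg_left (rate_le_of_norm_le hN₀ hP (ha n)) hwn.1.le
      _ ≤ wmax * (Pmax * y ^ 2 / N₀ / Real.log 2) := by
          gcongr
          · exact hwn.2
          · exact hmax n
      _ = wmax * Pmax / N₀ / Real.log 2 * y ^ 2 := by ring
  rw [one_div_mul_eq_div, div_le_iff₀ (by exact_mod_cast hN), mul_comm]
  exact hsum

theorem mul_weightedSumRate_le (hN₀ : 0 < N₀) (hP : ∀ n, 0 < P n) {Pmax x y C : ℝ}
    (hmax : ∀ n, P n ≤ Pmax) (hw : ∀ n, 0 < w n) (hx₀ : 0 ≤ x) (hC : 0 ≤ C)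
    (hCy : C * y ^ 2 ≤ x ^ 2 / (1 + Pmax * x ^ 2 / N₀)) {a b : Fin N → Fin K}
    (hb : ∀ n, ‖h n n (b n)‖ ≤ y) (hai : Function.Injective a) (ha : ∀ n, x ≤ ‖h n n (a n)‖) :
    C * weightedSumRate N₀ h P w b ≤ weightedSumRate N₀ h P w a := by
  rw [weightedSumRate, weightedSumRate, Finset.mul_sum]
  refine Finset.sum_le_sum fun n _ => ?_
  rw [mul_left_comm]
  refine mul_le_mul_of_nonneg_left ?_ (hw n).le
  have hPn := hP n
  have hlog := Real.log_pos one_lt_two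
  calc C * rate N₀ h P n b ≤ C * (P n * y ^ 2 / N₀ / Real.log 2) :=
        mul_le_mul_of_nonneg_left (rate_le_of_norm_le hN₀ hP (hb n)) hC
    _ = P n * (C * y ^ 2) / N₀ / Real.log 2 := by ring
    _ ≤ P n * (x ^ 2 / (1 + Pmax * x ^ 2 / N₀)) / N₀ / Real.log 2 := by gcongr
    _ ≤ rate N₀ h P n a := le_rate_of_le_norm hN₀ hP hai hx₀ (hmax n) (ha n)

/-- The strict inequality has a nonnegative left side, so no direct gain vanishes; this keeps the
denominator of the price of anarchy positive. -/
theorem StrongInterference.norm_pos (hSI : StrongInterference N₀ h P) (hN₀ : 0 < N₀)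
    (hP : ∀ n, 0 < P n) (n : Fin N) (k : Fin K) : 0 < ‖h n n k‖ := by
  have hJ (l : Fin K) : 0 ≤ ⨅ m : {m : Fin N // m ≠ n}, ‖h m.1 n l‖ ^ 2 * P m.1 :=
    Real.iInf_nonneg fun m' => mul_nonneg (sq_nonneg _) (hP m').le
  have hle : ⨅ k : Fin K, ‖h n n k‖ ^ 2 ≤ ‖h n n k‖ ^ 2 :=
    ciInf_le (f := fun k : Fin K => ‖h n n k‖ ^ 2) (Set.finite_range _).bddBelow k
  have hsup : 0 ≤ ⨆ l : Fin K, ‖h n n l‖ ^ 2 /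
      (N₀ + ⨅ m : {m : Fin N // m ≠ n}, ‖h m.1 n l‖ ^ 2 * P m.1) :=
    Real.iSup_nonneg fun l => div_nonneg (sq_nonneg _) (add_nonneg hN₀.le (hJ l))
  have hlt : 0 < 1 / N₀ * ⨅ k : Fin K, ‖h n n k‖ ^ 2 := hsup.trans_lt (hSI n)
  have hpos : 0 < ‖h n n k‖ ^ 2 :=
    ((mul_pos_iff_of_pos_left (one_div_pos.mpr hN₀)).mp hlt).trans_le hle
  exact (norm_nonneg _).lt_of_ne fun h0 => by simp [← h0] at hpos

end Network

theorem StrongInterference.norm_sq_div_le {N : ℕ} {N₀ : ℝ} {h : Fin N → Fin N → Fin N → ℂ}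
    {P : Fin N → ℝ} (hSI : StrongInterference N₀ h P) (hN₀ : 0 < N₀) (hP : ∀ n, 0 < P n)
    {n m : Fin N} (hmn : m ≠ n) (k l : Fin N) {I : ℝ} (hI : ‖h m n l‖ ^ 2 * P m ≤ I) :
    ‖h n n l‖ ^ 2 / (N₀ + I) ≤ ‖h n n k‖ ^ 2 / N₀ := by
  have hJ (l : Fin N) : 0 ≤ ⨅ m : {m : Fin N // m ≠ n}, ‖h m.1 n l‖ ^ 2 * P m.1 :=
    Real.iInf_nonneg fun m' => mul_nonneg (sq_nonneg _) (hP m').le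
  have hJI : ⨅ m : {m : Fin N // m ≠ n}, ‖h m.1 n l‖ ^ 2 * P m.1 ≤ I :=
    (ciInf_le (f := fun m : {m : Fin N // m ≠ n} => ‖h m.1 n l‖ ^ 2 * P m.1)
      (Set.finite_range _).bddBelow ⟨m, hmn⟩).trans hI
  have h₁ : ‖h n n l‖ ^ 2 / (N₀ + I) ≤
      ‖h n n l‖ ^ 2 / (N₀ + ⨅ m : {m : Fin N // m ≠ n}, ‖h m.1 n l‖ ^ 2 * P m.1) :=
    div_le_div_of_nonneg_left (sq_nonneg _) (by linarith [hJ l]) (by linarith)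
  have h₂ := le_ciSup (f := fun l : Fin N => ‖h n n l‖ ^ 2 /
    (N₀ + ⨅ m : {m : Fin N // m ≠ n}, ‖h m.1 n l‖ ^ 2 * P m.1)) (Set.finite_range _).bddAbove l
  have h₃ : 1 / N₀ * ⨅ k : Fin N, ‖h n n k‖ ^ 2 ≤ 1 / N₀ * ‖h n n k‖ ^ 2 :=
    mul_le_mul_of_nonneg_left (ciInf_le (f := fun k : Fin N => ‖h n n k‖ ^ 2)
      (Set.finite_range _).bddBelow k) (by positivity)
  exact h₁.trans (h₂.trans ((hSI n).le.trans (h₃.trans_eq (one_div_mul_eq_div _ _))))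

/-- Under strong interference, every allocation of distinct channels to all users is a pure Nash
equilibrium: each deviation leads to a channel that is occupied by another user. -/
theorem StrongInterference.isPureNash {N : ℕ} {N₀ : ℝ} {h : Fin N → Fin N → Fin N → ℂ}
    {P : Fin N → ℝ} (hSI : StrongInterference N₀ h P) (hN₀ : 0 < N₀) (hP : ∀ n, 0 < P n)
    {a : Fin N → Fin N} (ha : Function.Injective a) : (naiveFSIG N₀ h P).IsPureNash a := by
  intro n s
  change rate N₀ h P n (Function.update a n s) ≤ rate N₀ h P n a
  by_cases hs : s = a n
  · rw [hs, Function.update_eq_self]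
  obtain ⟨m, hm⟩ := Finite.surjective_of_injective ha s
  have hmn : m ≠ n := fun h => hs (by rw [← hm, h])
  have hPn := hP n
  have hI₀ := interference_nonneg (h := h) hP (Function.update a n s) n s
  have hI : ‖h m n s‖ ^ 2 * P m ≤ interference h P (Function.update a n s) n s :=
    Finset.single_le_sum (f := fun m' => ‖h m' n s‖ ^ 2 * P m')
      (fun m' _ => mul_nonneg (sq_nonneg _) (hP m').le) (by simp [hmn, hm])
  have key := mul_le_mul_of_nonneg_left (hSI.norm_sq_div_le hN₀ hP hmn (a n) s hI) hPn.le
  rw [rate_of_injective ha, rate, Function.update_self, mul_div_assoc, mul_div_assoc]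
  exact Real.logb_le_logb_of_le one_lt_two (by positivity) (by linarith)

/-! ### Random coefficients and the main theorem -/

section Random

variable {Ω : Type*} [MeasurableSpace Ω] {Pr : Measure Ω} [IsProbabilityMeasure Pr]

/-- If the direct coefficients are independent and lie in `T` with probability bounded away from
`0`, then asymptotically almost surely at least `⌈N ^ μ⌉!` allocations of distinct channels have all
their direct coefficients in `T`. -/
theorem tendsto_measure_ncard_allocations_lt {h : (N : ℕ) → Fin N → Fin N → Fin N → Ω → ℂ}
    (hindep : ∀ N, iIndepFun
      (fun (i : Fin N × Fin N × Fin N) (ω : Ω) => h N i.1 i.2.1 i.2.2 ω) Pr)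
    {T : Set ℂ} (hT : MeasurableSet T) {r : ℝ} (hr₀ : 0 ≤ r) (hr : r < 1)
    (hTr : ∀ N n k, Pr.real {ω | h N n n k ω ∈ Tᶜ} ≤ r) {μ : ℝ} (hμ : μ < 1) :
    Tendsto (fun N : ℕ => Pr {ω | {f : Fin N → Fin N | Function.Injective f ∧
      ∀ n, h N n n (f n) ω ∈ T}.ncard < ⌈(N : ℝ) ^ μ⌉₊ !}) atTop (𝓝 0) := by
  refine tendsto_measure_ncard_matchings_lt (E := fun N n k => {ω | h N n n k ω ∈ T})
    hr (fun N S => ?_) hμ hr₀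
  have hinj : Function.Injective (fun i : Fin N × Fin N => (i.1, i.1, i.2)) := by
    rintro ⟨n, k⟩ ⟨n', k'⟩ h
    simpa using h
  have := ((hindep N).precomp hinj).measure_inter_preimage_eq_mul S (sets := fun _ => Tᶜ)
    (fun _ _ => hT.compl)
  have heq : Pr.real (⋂ i ∈ S, {ω | h N i.1 i.1 i.2 ω ∈ T}ᶜ) =
      ∏ i ∈ S, Pr.real {ω | h N i.1 i.1 i.2 ω ∈ Tᶜ} := by
    simp only [Measure.real]
    rw [← ENNReal.toReal_prod]
    exact congrArg ENNReal.toReal this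
  rw [heq]
  exact (Finset.prod_le_prod (fun _ _ => measureReal_nonneg) fun i _ => hTr N i.1 i.2).trans_eq
    (Finset.prod_const r)

theorem measureReal_norm_le_eq_cdf {g : Ω → ℂ} (hg : Measurable g) (x : ℝ) :
    Pr.real {ω | ‖g ω‖ ≤ x} = cdf (Pr.map fun ω => ‖g ω‖) x := by
  have := Measure.isProbabilityMeasure_map (μ := Pr) hg.norm.aemeasurable
  rw [cdf_eq_real, map_measureReal_apply hg.norm measurableSet_Iic]
  rfl

end Random

end InterferenceNetwork

open InterferenceNetwork in
theorem mainTheorem1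
    {Ω : Type*} [MeasurableSpace Ω] (Pr : Measure Ω) [IsProbabilityMeasure Pr]
    -- for every `N` a network with `N` users and `N` channels
    (h : (N : ℕ) → Fin N → Fin N → Fin N → Ω → ℂ)
    (N₀ : ℝ) (P w : (N : ℕ) → Fin N → ℝ) (Pmax wmin wmax : ℝ)
    (F : (N : ℕ) → Fin N → ℝ → ℝ)
    (hmeas : ∀ N m n k, Measurable (h N m n k))
    -- all coefficients of the `N`-th network are independent
    (hindep : ∀ N, iIndepFun
      (fun (i : Fin N × Fin N × Fin N) (ω : Ω) => h N i.1 i.2.1 i.2.2 ω) Pr)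
    -- the direct gains of user `n` all have the continuous distribution function `F N n`
    (hF : ∀ N n k x, cdf (Pr.map (fun ω => ‖h N n n k ω‖)) x = F N n x)
    (hFcont : ∀ N n, Continuous (F N n))
    -- `F N n x > 0` for all `x > 0`, uniformly in the users
    (hFpos : ∀ x : ℝ, 0 < x → ∃ c : ℝ, 0 < c ∧ ∀ N n, c ≤ F N n x)
    (hN₀ : 0 < N₀)
    (hP : ∀ N n, 0 < P N n ∧ P N n ≤ Pmax)
    (hwmin : 0 < wmin)
    (hw : ∀ N n, wmin ≤ w N n ∧ w N n ≤ wmax) :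
    -- many bad pure Nash equilibria
    (∀ μ : ℝ, μ < 1 →
      ∃ S : (N : ℕ) → Ω → Finset (Fin N → Fin N),
        (∀ N ω, ∀ a ∈ S N ω,
          (naiveFSIG N₀ (fun m n k => h N m n k ω) (P N)).IsPureNash a) ∧
        Tendsto (fun N : ℕ => Pr {ω |
          StrongInterference N₀ (fun m n k => h N m n k ω) (P N) ∧
            (S N ω).card < ⌈(N : ℝ) ^ μ⌉₊ !}) atTop (𝓝 0) ∧
        ∀ ε : ℝ, 0 < ε → Tendsto (fun N : ℕ => Pr {ω | ∃ a ∈ S N ω,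
          ε ≤ 1 / (N : ℝ) *
            weightedSumRate N₀ (fun m n k => h N m n k ω) (P N) (w N) a}) atTop (𝓝 0)) ∧
    -- the pure price of anarchy tends to infinity, if the direct gains do not degenerate to `0`
    ((∃ x q : ℝ, 0 < x ∧ q < 1 ∧ ∀ N n, F N n x ≤ q) →
      ∀ C : ℝ, Tendsto (fun N : ℕ => Pr {ω |
        StrongInterference N₀ (fun m n k => h N m n k ω) (P N) ∧
          (naiveFSIG N₀ (fun m n k => h N m n k ω) (P N)).purePriceOfAnarchy
            (weightedSumRate N₀ (fun m n k => h N m n k ω) (P N) (w N)) < C}) atTop (𝓝 0)) := by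
  -- The network with one user serves below as a witness that the uniform bounds are nonvacuous.
  have hPpos N n : 0 < P N n := (hP N n).1
  have hwpos N n : 0 < w N n := hwmin.trans_le (hw N n).1
  have hPmax : 0 < Pmax := (hPpos 1 0).trans_le (hP 1 0).2
  have hFle N n k x : Pr.real {ω | ‖h N n n k ω‖ ≤ x} = F N n x := by
    rw [measureReal_norm_le_eq_cdf (hmeas N n n k), hF]
  have hsmall (y : ℝ) (hy : 0 < y) (μ : ℝ) (hμ : μ < 1) :
      Tendsto (fun N : ℕ => Pr {ω | {f : Fin N → Fin N | Function.Injective f ∧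
        ∀ n, h N n n (f n) ω ∈ {z : ℂ | ‖z‖ ≤ y}}.ncard < ⌈(N : ℝ) ^ μ⌉₊ !}) atTop (𝓝 0) := by
    obtain ⟨c, hc, hcF⟩ := hFpos y hy
    have hF₁ : c ≤ 1 := (hcF 1 0).trans (by rw [← hFle 1 0 0]; exact measureReal_le_one)
    refine tendsto_measure_ncard_allocations_lt hindep (T := {z | ‖z‖ ≤ y})
      (measurableSet_le measurable_norm measurable_const) (sub_nonneg.mpr hF₁)
      (by linarith : 1 - c < 1) (fun N n k => ?_) hμ
    have : {ω | h N n n k ω ∈ {z : ℂ | ‖z‖ ≤ y}ᶜ} = {ω | ‖h N n n k ω‖ ≤ y}ᶜ := rfl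
    rw [this, measureReal_compl (measurableSet_le (hmeas N n n k).norm measurable_const),
      probReal_univ, hFle]
    linarith [hcF N n]
  refine ⟨fun μ hμ => ?_, ?_⟩
  · classical
    let pne N ω : Finset (Fin N → Fin N) := Finset.univ.filter
      (naiveFSIG N₀ (fun m n k => h N m n k ω) (P N)).IsPureNash
    let avg N ω (a : Fin N → Fin N) : ℝ := 1 / (N : ℝ) *
      weightedSumRate N₀ (fun m n k => h N m n k ω) (P N) (w N) a
    choose S hS hcard hbad using fun (N : ℕ) (ω : Ω) =>
      exists_subset_card_eq_min_of_smallest (pne N ω) (avg N ω) ⌈(N : ℝ) ^ μ⌉₊ !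
    -- Off strong interference, equilibria need not be bad or plentiful, so the set is left empty
    -- there.
    refine ⟨fun N ω => if StrongInterference N₀ (fun m n k => h N m n k ω) (P N) then S N ω else ∅,
      fun N ω a ha => ?_, ?_, fun ε hε => ?_⟩
    · dsimp only at ha
      split_ifs at ha
      · exact (Finset.mem_filter.mp (hS N ω ha)).2
      · simp at ha
    · refine tendsto_of_tendsto_of_tendsto_of_le_of_le tendsto_const_nhds (hsmall 1 one_pos μ hμ)
        (fun N => zero_le) fun N => measure_mono fun ω hω => ?_
      obtain ⟨hSI, hlt⟩ := hω
      dsimp only at hlt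
      rw [if_pos hSI, hcard] at hlt
      refine lt_of_le_of_lt ?_ ((min_lt_iff.mp hlt).resolve_left (lt_irrefl _))
      rw [← Set.ncard_coe_finset]
      refine Set.ncard_le_ncard fun a ha => ?_
      simpa [pne] using hSI.isPureNash hN₀ (hPpos N) ha.1
    · obtain ⟨y, hy, hyε⟩ := exists_pos_mul_sq_lt (wmax * Pmax / N₀ / Real.log 2) hε
      refine tendsto_of_tendsto_of_tendsto_of_le_of_le tendsto_const_nhds (hsmall y hy μ hμ)
        (fun N => zero_le) fun N => measure_mono fun ω hω => ?_
      obtain ⟨a, ha, hεa⟩ := hω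
      dsimp only at ha
      split_ifs at ha with hSI
      -- If a selected equilibrium has average at least `ε`, too few equilibria lie below `ε`; but
      -- all matchings with gains `≤ y` do.
      · refine lt_of_le_of_lt ?_ (hbad N ω a ha ε hεa)
        rw [← Set.ncard_coe_finset]
        refine Set.ncard_le_ncard fun b hb => ?_
        rw [Finset.mem_coe, Finset.mem_filter, Finset.mem_filter]
        exact ⟨⟨Finset.mem_univ _, hSI.isPureNash hN₀ (hPpos N) hb.1⟩,
          average_weightedSumRate_lt hN₀ (hPpos N) (fun n => (hP N n).2)
            (fun n => ⟨hwpos N n, (hw N n).2⟩) hε hyε hb.2⟩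
      · simp at ha
  · rintro ⟨x, q, hx, hq, hFq⟩ C
    have hq₀ : 0 ≤ q := (hFle 1 0 0 x ▸ measureReal_nonneg).trans (hFq 1 0)
    have hlarge := tendsto_measure_ncard_allocations_lt hindep (T := {z | ‖z‖ ≤ x}ᶜ)
      (measurableSet_le measurable_norm measurable_const).compl hq₀ hq (fun N n k => by
        rw [compl_compl]
        exact (hFle N n k x).trans_le (hFq N n)) (zero_lt_one (α := ℝ))
    obtain ⟨y, hy, hyx⟩ := exists_pos_mul_sq_lt |C|
      (by positivity : 0 < x ^ 2 / (1 + Pmax * x ^ 2 / N₀))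
    -- With `μ = 0` the threshold is `1! = 1`: one matching of each kind suffices.
    have hlim := (hsmall y hy 0 one_pos).add hlarge
    rw [add_zero] at hlim
    refine tendsto_of_tendsto_of_tendsto_of_le_of_le' tendsto_const_nhds hlim
      (Eventually.of_forall fun N => zero_le) ?_
    filter_upwards [eventually_gt_atTop 0] with N hN
    refine (measure_mono fun ω hω => ?_).trans (measure_union_le _ _)
    obtain ⟨hSI, hlt⟩ := hω
    by_contra hcon
    simp only [Set.mem_union, Set.mem_ofPred_eq, not_or, not_lt, Real.rpow_zero, Nat.ceil_one,
      Nat.factorial_one, Nat.one_le_iff_ne_zero] at hcon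
    obtain ⟨b, hbi, hb⟩ := Set.nonempty_of_ncard_ne_zero hcon.1
    obtain ⟨a, hai, ha⟩ := Set.nonempty_of_ncard_ne_zero hcon.2
    have hWpos := weightedSumRate_pos (h := fun m n k => h N m n k ω) (K := N) hN hN₀ (hPpos N)
      (hwpos N) (hSI.norm_pos hN₀ (hPpos N))
    refine hlt.not_ge (NormalFormGame.le_purePriceOfAnarchy (a := a) hWpos
      (hSI.isPureNash hN₀ (hPpos N) hbi) ?_)
    exact (mul_le_mul_of_nonneg_right (le_abs_self C) (hWpos b).le).trans
      (mul_weightedSumRate_le hN₀ (hPpos N) (fun n => (hP N n).2) (hwpos N) hx.le (abs_nonneg C)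
        hyx.le hb hai fun n => le_of_not_ge (ha n))
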